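/- Let $\mathcal{C}_n=\{0,1\}^n$ carry componentwise addition modulo $2$ and the Hamming distance; the weight of a word is its number of nonzero entries. For a set $P$ of natural numbers, a $P$-isometry is a bijection $\phi:\mathcal{C}_n\to\mathcal{C}_n$ such that $d(\phi(x),\phi(y))=p$ whenever $d(x,y)=p\in P$; an isometry is a bijection preserving all Hamming distances. Let $T_a$ be the translation $c\mapsto c+a$, and let $\overline{1}^j$ be the word with $0$ in position $j$ and $1$ in every other position. Given positions $i,j\in\{1,\dots,n\}$ (possibly equal) and a bijection $\sigma:\{1,\dots,n\}\setminus\{i\}\to\{1,\dots,n\}\setminus\{j\}$, the associated $\sigma_{ij}$-mapping $\tau:\mathcal{C}_n\to\mathcal{C}_n$ sends $c$ to the word $d$ with $d_k=c_{\sigma^{-1}(k)}$ for $k\ne j$ and $d_j=0$ if $c_i=0$, and with $d_k=c_{\sigma^{-1}(k)}+1$ for $k\neq j$ and $d_j=1$ if $c_i=1$. If $n\equiv 1\pmod 4$, then every $\{\frac{n-1}{2},\frac{n+1}{2},n\}$-isometry $\phi$ of $\mathcal{C}_n$ with $\phi(\overline{0})=\overline{0}$ is an isometry. If $n\equiv 3\pmod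 4$, then for every $\{\frac{n-1}{2},\frac{n+1}{2},n\}$-isometry $\phi$ of $\mathcal{C}_n$ with $\phi(\overline{0})=\overline{0}$ that is not an isometry, there are positions $i,j$ and a $\sigma_{ij}$-mapping $\tau$ such that $\phi(c)=\tau(c)$ for all words $c$ of even weight and $\phi(c)=T_{\overline{1}^j}(\tau(c))$ for all words $c$ of odd weight. Conversely, for all positions $i,j$ and every $\sigma_{ij}$-mapping $\tau$, the map so defined is an $\{\frac{n-1}{2},\frac{n+1}{2},n\}$-isometry fixing $\overline{0}$. -/

import Mathlib

/-- The words of length `n`: the Boolean cube `{0,1}^n` with componentwise addition modulo 2.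
Distances are Hamming distances `hammingDist`, weights are Hamming norms `hammingNorm`. -/
abbrev Word (n : ℕ) : Type := Fin n → ZMod 2

/-- A `P`-isometry of the Boolean cube: a bijection preserving every Hamming distance in `P`. -/
def IsWeakIsometry {n : ℕ} (P : Set ℕ) (φ : Word n → Word n) : Prop :=
  Function.Bijective φ ∧
    ∀ p ∈ P, ∀ x y : Word n, hammingDist x y = p → hammingDist (φ x) (φ y) = p

/-- An isometry of the Boolean cube: a bijection preserving all Hamming distances. -/
def IsCubeIsometry {n : ℕ} (φ : Word n → Word n) : Prop :=
  Function.Bijective φ ∧ ∀ x y : Word n, hammingDist (φ x) (φ y) = hammingDist x y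

/-- The translation `c ↦ c + a`. -/
def translation {n : ℕ} (a : Word n) : Word n → Word n := fun c => c + a

/-- The word with entry `0` in position `j` and entry `1` in all other positions. -/
def onesExcept {n : ℕ} (j : Fin n) : Word n := fun k => if k = j then 0 else 1

/-- `τ` is the mapping of the cube attached to positions `i`, `j` and a bijection `σ` from the
positions other than `i` to the positions other than `j`. -/
def IsSigmaMappingOf {n : ℕ} (i j : Fin n) (σ : {k : Fin n // k ≠ i} ≃ {k : Fin n // k ≠ j})
    (τ : Word n → Word n) : Prop :=
  ∀ c : Word n,
    (c i = 0 → (∀ k : {k : Fin n // k ≠ j}, τ c k = c (σ.symm k)) ∧ τ c j = 0) ∧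
    (c i = 1 → (∀ k : {k : Fin n // k ≠ j}, τ c k = c (σ.symm k) + 1) ∧ τ c j = 1)

/-- `τ` is a `σ_{i,j}`-mapping, for some bijection `σ`. -/
def IsSigmaMapping {n : ℕ} (i j : Fin n) (τ : Word n → Word n) : Prop :=
  ∃ σ : {k : Fin n // k ≠ i} ≃ {k : Fin n // k ≠ j}, IsSigmaMappingOf i j σ τ

/-- `φ` equals a `σ_{i,j}`-mapping `τ` on the words of even weight, and `τ` followed by the
translation by `onesExcept j` on the words of odd weight. -/
def IsTwistedSigmaMapping {n : ℕ} (φ : Word n → Word n) : Prop :=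
  ∃ (i j : Fin n) (τ : Word n → Word n), IsSigmaMapping i j τ ∧
    (∀ c : Word n, Even (hammingNorm c) → φ c = τ c) ∧
    (∀ c : Word n, Odd (hammingNorm c) → φ c = (translation (onesExcept j) ∘ τ) c)

/-! Write `n = 2m + 1`. A bijection that preserves the distance `m` preserves, for each pair of
words, the number of words at distance `m` from both. This number vanishes at odd distances; at
distance `2a` it is half the product of the central binomial coefficients of `a` and `m + 1 - a`.
Central binomial coefficients are strictly log-convex, so the product determines the unordered pair,
and an even distance is known up to the reflection `d ↦ n + 1 - d`. In particular the set `{2, n -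
1}` is preserved.

For `m` even, reflection swaps `m` and `m + 2`, so `m + 2` is preserved too. Counting words at
distances `m` and `m + 2` then separates `2` from `n - 1`. Preserving `n` means commuting with
complementation, which turns `n - 1` into `1`, and preserving distance `1` gives an isometry.

For `m ≥ 3`, words are subsets of `n + 1` extended positions modulo complementation (`code`), and
distance `2` or `n - 1` means differing by a pair. The neighbours of a word thus form the graph of
pairs of extended positions, whose automorphisms come from permutations
(`exists_perm_of_card_inter`). Neighbouring words get the same permutation (`local_perm_translate`),
so a single `π` describes `φ` on even words, and complementation carries it to odd ones. If `π`
fixes the extra point, `φ` is an isometry; otherwise it is a twisted mapping.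

Conversely, a twisted mapping is additive, so only its effect on weights matters. -/

/-! ### Log-convexity of central binomial coefficients -/

theorem centralBinom_succ_mul_lt {a b : ℕ} (h : a < b) :
    (a + 1).centralBinom * b.centralBinom < a.centralBinom * (b + 1).centralBinom := by
  have ha := Nat.succ_mul_centralBinom_succ a
  have hb := Nat.succ_mul_centralBinom_succ b
  have hpa := Nat.centralBinom_pos a
  have hpb := Nat.centralBinom_pos b
  have hpos : 0 < a.centralBinom * b.centralBinom := Nat.mul_pos hpa hpb
  have h1 : (a + 1) * (b + 1) * ((a + 1).centralBinom * b.centralBinom)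
      = (b + 1) * (2 * (2 * a + 1)) * (a.centralBinom * b.centralBinom) := by
    calc _ = (b + 1) * ((a + 1) * (a + 1).centralBinom) * b.centralBinom := by ring
      _ = _ := by rw [ha]; ring
  have h2 : (a + 1) * (b + 1) * (a.centralBinom * (b + 1).centralBinom)
      = (a + 1) * (2 * (2 * b + 1)) * (a.centralBinom * b.centralBinom) := by
    calc _ = (a + 1) * ((b + 1) * (b + 1).centralBinom) * a.centralBinom := by ring
      _ = _ := by rw [hb]; ring
  -- The ratio of consecutive coefficients is `2(2a+1)/(a+1) = 4 - 2/(a+1)`, strictly increasing in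
  -- `a`.
  have h3 : (b + 1) * (2 * (2 * a + 1)) < (a + 1) * (2 * (2 * b + 1)) := by nlinarith
  refine Nat.lt_of_mul_lt_mul_left (a := (a + 1) * (b + 1)) ?_
  rw [h1, h2]
  exact Nat.mul_lt_mul_of_pos_right h3 hpos

theorem centralBinom_mul_lt_of_lt {a c b d : ℕ} (hac : a < c) (hcd : c ≤ d) (hs : a + b = c + d) :
    c.centralBinom * d.centralBinom < a.centralBinom * b.centralBinom := by
  induction c, hac using Nat.le_induction generalizing d with
  | base =>
    obtain rfl : b = d + 1 := by omega
    exact centralBinom_succ_mul_lt (by omega)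
  | succ c hac ih =>
    exact (centralBinom_succ_mul_lt (by omega)).trans (ih (d := d + 1) (by omega) (by omega))

theorem eq_or_eq_of_centralBinom_mul_eq {a b c d : ℕ} (hs : a + b = c + d)
    (h : a.centralBinom * b.centralBinom = c.centralBinom * d.centralBinom) : a = c ∨ a = d := by
  wlog hab : a ≤ b generalizing a b
  · rcases this (a := b) (b := a) (by omega) (by rw [mul_comm, h]) (by omega) with h | h <;> omega
  wlog hcd : c ≤ d generalizing c d
  · exact (this (c := d) (d := c) (by omega) (by rw [h, mul_comm]) (by omega)).symm
  rcases lt_trichotomy a c with h1 | h1 | h1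
  · exact absurd h (centralBinom_mul_lt_of_lt h1 hcd hs).ne'
  · exact Or.inl h1
  · exact absurd h (centralBinom_mul_lt_of_lt h1 hab hs.symm).ne

theorem two_mul_choose_mul_choose {m a : ℕ} (ha : a ≤ m) :
    2 * ((2 * a).choose a * (2 * m + 1 - 2 * a).choose (m - a))
      = a.centralBinom * (m + 1 - a).centralBinom := by
  obtain ⟨b, rfl⟩ := Nat.exists_eq_add_of_le ha
  have h1 : 2 * (a + b) + 1 - 2 * a = 2 * b + 1 := by omega
  have h2 : a + b + 1 - a = b + 1 := by omega
  have h3 : (2 * b + 1).choose (b + 1) = (2 * b + 1).choose b :=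
    Nat.choose_symm_of_eq_add (by omega)
  have h4 : (b + 1).centralBinom = 2 * (2 * b + 1).choose b := by
    rw [Nat.centralBinom_eq_two_mul_choose, show 2 * (b + 1) = 2 * b + 1 + 1 by ring,
      Nat.choose_succ_succ, h3]; ring
  rw [h1, h2, h4, Nat.add_sub_cancel_left, Nat.centralBinom_eq_two_mul_choose]
  ring

/-! ### Counting words at given distances from two words -/

theorem card_filter_inter_sdiff {α : Type*} [Fintype α] [DecidableEq α] (Y : Finset α) (a b : ℕ) :
    (Finset.univ.filter fun Z : Finset α => (Z ∩ Y).card = a ∧ (Z \ Y).card = b).card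
      = Y.card.choose a * (Fintype.card α - Y.card).choose b := by
  rw [← Finset.card_compl, ← Finset.card_powersetCard, ← Finset.card_powersetCard b,
    ← Finset.card_product]
  refine Finset.card_nbij' (fun Z => (Z ∩ Y, Z \ Y)) (fun p => p.1 ∪ p.2) ?_ ?_ ?_ ?_
  · intro Z hZ
    simp only [Finset.coe_filter, Finset.mem_univ, true_and, Set.mem_ofPred_eq] at hZ
    simp only [Finset.coe_product, Set.mem_prod, Finset.mem_coe, Finset.mem_powersetCard]
    refine ⟨⟨Finset.inter_subset_right, hZ.1⟩, ⟨?_, hZ.2⟩⟩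
    intro i; simp
  · rintro ⟨A, B⟩ h
    simp only [Finset.coe_product, Set.mem_prod, Finset.mem_coe, Finset.mem_powersetCard] at h
    obtain ⟨⟨hA, rfl⟩, hB, rfl⟩ := h
    have hB' : ∀ i ∈ B, i ∉ Y := fun i hi => by simpa using hB hi
    have e1 : (A ∪ B) ∩ Y = A := by ext i; have := @hA i; have := hB' i; grind
    have e2 : (A ∪ B) \ Y = B := by ext i; have := @hA i; have := hB' i; grind
    simp [e1, e2]
  · intro Z _; ext i; simp; tauto
  · rintro ⟨A, B⟩ h
    simp only [Finset.coe_product, Set.mem_prod, Finset.mem_coe, Finset.mem_powersetCard] at h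
    obtain ⟨⟨hA, -⟩, hB, -⟩ := h
    have hB' : ∀ i ∈ B, i ∉ Y := fun i hi => by simpa using hB hi
    have e1 : (A ∪ B) ∩ Y = A := by ext i; have := @hA i; have := hB' i; grind
    have e2 : (A ∪ B) \ Y = B := by ext i; have := @hA i; have := hB' i; grind
    simp [e1, e2]

/-- The set of positions in which two words differ. -/
def diffSet {n : ℕ} (x y : Word n) : Finset (Fin n) := Finset.univ.filter fun i => x i ≠ y i

theorem card_diffSet {n : ℕ} (x y : Word n) : (diffSet x y).card = hammingDist x y := rfl

/-- The word whose support is `S`. -/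
def indicatorWord {n : ℕ} (S : Finset (Fin n)) : Word n := fun i => if i ∈ S then 1 else 0

theorem diffSet_add_indicatorWord {n : ℕ} (x : Word n) (S : Finset (Fin n)) :
    diffSet x (x + indicatorWord S) = S := by
  ext i; simp [diffSet, indicatorWord]

theorem add_indicatorWord_diffSet {n : ℕ} (x y : Word n) :
    x + indicatorWord (diffSet x y) = y := by
  ext i
  simp only [Pi.add_apply, indicatorWord, diffSet, Finset.mem_filter, Finset.mem_univ, true_and]
  generalize x i = a
  generalize y i = b
  revert a b; decide

theorem diffSet_symmDiff {n : ℕ} (x y z : Word n) :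
    diffSet y z = symmDiff (diffSet x z) (diffSet x y) := by
  ext i
  simp only [diffSet, Finset.mem_symmDiff, Finset.mem_filter, Finset.mem_univ, true_and]
  generalize x i = a
  generalize y i = b
  generalize z i = c
  revert a b c; decide

/-- The number of words at distances `s` and `t` from `x` and `y`. -/
def sphereCount {n : ℕ} (s t : ℕ) (x y : Word n) : ℕ :=
  (Finset.univ.filter fun z : Word n => hammingDist x z = s ∧ hammingDist y z = t).card

theorem sphereCount_eq_card_finset {n : ℕ} (s t : ℕ) (x y : Word n) :
    sphereCount s t x y = (Finset.univ.filter fun Z : Finset (Fin n) =>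
      Z.card = s ∧ (symmDiff Z (diffSet x y)).card = t).card := by
  refine Finset.card_nbij' (fun z => diffSet x z) (fun Z => x + indicatorWord Z) ?_ ?_ ?_ ?_
  · intro z hz
    simp only [Finset.coe_filter, Finset.mem_univ, true_and, Set.mem_ofPred_eq] at hz ⊢
    rw [← diffSet_symmDiff, card_diffSet, card_diffSet]; exact hz
  · intro Z hZ
    simp only [Finset.coe_filter, Finset.mem_univ, true_and, Set.mem_ofPred_eq] at hZ ⊢
    rw [← card_diffSet, ← card_diffSet, diffSet_symmDiff x y, diffSet_add_indicatorWord]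
    exact hZ
  · intro z _; exact add_indicatorWord_diffSet x z
  · intro Z _; exact diffSet_add_indicatorWord x Z

theorem card_symmDiff_add {α : Type*} [DecidableEq α] (Z Y : Finset α) :
    Z.card = (Z ∩ Y).card + (Z \ Y).card ∧
      (symmDiff Z Y).card + (Z ∩ Y).card = (Z \ Y).card + Y.card := by
  have h1 := Finset.card_inter_add_card_sdiff Z Y
  have h2 := Finset.card_inter_add_card_sdiff Y Z
  have h3 : (symmDiff Z Y).card = (Z \ Y).card + (Y \ Z).card := by
    rw [symmDiff_def]
    exact Finset.card_union_of_disjoint disjoint_sdiff_sdiff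
  rw [Finset.inter_comm] at h2
  omega

/-- The distances `s` and `t` fix how many changed positions lie inside (`a`) and outside (`b`) the
difference set. -/
theorem sphereCount_eq {n s t a b : ℕ} {x y : Word n} (hs : s = a + b)
    (ht : t + a = b + hammingDist x y) :
    sphereCount s t x y = (hammingDist x y).choose a * (n - hammingDist x y).choose b := by
  rw [sphereCount_eq_card_finset]
  have := card_filter_inter_sdiff (diffSet x y) a b
  rw [Fintype.card_fin, card_diffSet] at this
  rw [← this]
  congr 1
  ext Z
  have := card_symmDiff_add Z (diffSet x y)
  rw [card_diffSet] at this
  simp only [Finset.mem_filter, Finset.mem_univ, true_and]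
  omega

theorem sphereCount_self_eq_zero {n s : ℕ} {x y : Word n} (h : Odd (hammingDist x y)) :
    sphereCount s s x y = 0 := by
  rw [sphereCount_eq_card_finset, Finset.card_eq_zero, Finset.filter_eq_empty_iff]
  rintro Z - ⟨h1, h2⟩
  have := card_symmDiff_add Z (diffSet x y)
  rw [card_diffSet] at this
  obtain ⟨k, hk⟩ := h
  omega

theorem hammingDist_le {n : ℕ} (x y : Word n) : hammingDist x y ≤ n := by
  simpa using hammingDist_le_card_fintype (x := x) (y := y)

theorem two_mul_sphereCount {m a : ℕ} {x y : Word (2 * m + 1)} (h : hammingDist x y = 2 * a) :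
    2 * sphereCount m m x y = a.centralBinom * (m + 1 - a).centralBinom := by
  have hle := hammingDist_le x y
  rw [← two_mul_choose_mul_choose (by omega),
    sphereCount_eq (a := a) (b := m - a) (by omega) (by omega), h]

/-- Two pairs with the same sphere count have even distances that agree or add up to `n + 1`. -/
theorem hammingDist_of_sphereCount_eq {m a : ℕ} {x y x' y' : Word (2 * m + 1)}
    (h : hammingDist x y = 2 * a) (hc : sphereCount m m x y = sphereCount m m x' y') :
    hammingDist x' y' = 2 * a ∨ hammingDist x' y' = 2 * (m + 1 - a) := by
  have h2 := two_mul_sphereCount h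
  have hle := hammingDist_le x y
  have hle' := hammingDist_le x' y'
  rcases Nat.even_or_odd (hammingDist x' y') with ⟨b, hb⟩ | ho
  · have h3 := two_mul_sphereCount (show hammingDist x' y' = 2 * b by omega)
    rw [← hc, h2] at h3
    rcases eq_or_eq_of_centralBinom_mul_eq (by omega) h3 with h | h <;> omega
  · rw [hc, sphereCount_self_eq_zero ho] at h2
    have := Nat.mul_pos (Nat.centralBinom_pos a) (Nat.centralBinom_pos (m + 1 - a))
    omega

/-! ### Distances recovered from the counts -/

/-- `φ` preserves and reflects the distance `p`. -/
def PreservesDist {n : ℕ} (φ : Word n → Word n) (p : ℕ) : Prop :=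
  ∀ x y : Word n, hammingDist (φ x) (φ y) = p ↔ hammingDist x y = p

/-- The map induced on the finite set of pairs at distance `p` is injective, hence surjective, so
the distance is also reflected. -/
theorem IsWeakIsometry.preservesDist {n : ℕ} {P : Set ℕ} {φ : Word n → Word n}
    (h : IsWeakIsometry P φ) {p : ℕ} (hp : p ∈ P) : PreservesDist φ p := by
  intro x y
  refine ⟨fun hxy => ?_, h.2 p hp x y⟩
  let F : {q : Word n × Word n // hammingDist q.1 q.2 = p} →
      {q : Word n × Word n // hammingDist q.1 q.2 = p} :=
    fun q => ⟨(φ q.1.1, φ q.1.2), h.2 p hp _ _ q.2⟩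
  have hF : Function.Injective F := by
    rintro ⟨⟨a, b⟩, _⟩ ⟨⟨c, d⟩, _⟩ hq
    simp only [F, Subtype.mk.injEq, Prod.mk.injEq] at hq ⊢
    exact ⟨h.1.1 hq.1, h.1.1 hq.2⟩
  obtain ⟨⟨⟨a, b⟩, hab⟩, hq⟩ := Finite.surjective_of_injective hF ⟨(φ x, φ y), hxy⟩
  simp only [F, Subtype.mk.injEq, Prod.mk.injEq] at hq
  rw [← h.1.1 hq.1, ← h.1.1 hq.2]; exact hab

theorem sphereCount_map {n s t : ℕ} {φ : Word n → Word n} (hφ : Function.Bijective φ)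
    (hs : PreservesDist φ s) (ht : PreservesDist φ t) (x y : Word n) :
    sphereCount s t x y = sphereCount s t (φ x) (φ y) := by
  refine Finset.card_bijective φ hφ fun z => ?_
  simp [hs x z, ht y z]

/-- Weak isometries preserve the set of distances `{2, n - 1}`. -/
theorem two_or_preserved {m : ℕ} {φ : Word (2 * m + 1) → Word (2 * m + 1)}
    (hφ : Function.Bijective φ) (hm : PreservesDist φ m) (x y : Word (2 * m + 1)) :
    (hammingDist (φ x) (φ y) = 2 ∨ hammingDist (φ x) (φ y) = 2 * m) ↔
      (hammingDist x y = 2 ∨ hammingDist x y = 2 * m) := by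
  have hc := sphereCount_map hφ hm hm x y
  have h0 : hammingDist (φ x) (φ y) = 0 ↔ hammingDist x y = 0 := by
    simp [hammingDist_eq_zero, hφ.1.eq_iff]
  have h1 := hammingDist_le x y
  have h2 := hammingDist_le (φ x) (φ y)
  constructor
  · rintro (h | h)
    · rcases hammingDist_of_sphereCount_eq (a := 1) h hc.symm with h | h <;> omega
    · rcases hammingDist_of_sphereCount_eq (a := m) h hc.symm with h | h <;> omega
  · rintro (h | h)
    · rcases hammingDist_of_sphereCount_eq (a := 1) h hc with h | h <;> omega
    · rcases hammingDist_of_sphereCount_eq (a := m) h hc with h | h <;> omega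

/-- The reflection partner of `m + 2` is `m`, which is already preserved. -/
theorem preservesDist_add_two {m : ℕ} {φ : Word (2 * m + 1) → Word (2 * m + 1)}
    (hφ : Function.Bijective φ) (hm : PreservesDist φ m) (he : Even m) :
    PreservesDist φ (m + 2) := by
  intro x y
  have hc := sphereCount_map hφ hm hm x y
  have := hm x y
  obtain ⟨a, ha⟩ := he
  constructor
  · intro h
    rcases hammingDist_of_sphereCount_eq (a := a + 1) (by omega) hc.symm with h | h <;> omega
  · intro h
    rcases hammingDist_of_sphereCount_eq (a := a + 1) (by omega) hc with h | h <;> omega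

/-- The counts are `C(2m-1, m)` and `C(2m, m-1)`; by Pascal's rule and symmetry they differ by
`C(2m-1, m-2) > 0`. -/
theorem sphereCount_two_ne {m : ℕ} (hm : 2 ≤ m) {x y x' y' : Word (2 * m + 1)}
    (h : hammingDist x y = 2) (h' : hammingDist x' y' = 2 * m) :
    sphereCount m (m + 2) x y ≠ sphereCount m (m + 2) x' y' := by
  rw [sphereCount_eq (a := 0) (b := m) (by omega) (by omega),
    sphereCount_eq (a := m - 1) (b := 1) (by omega) (by omega), h, h']
  obtain ⟨k, rfl⟩ := Nat.exists_eq_add_of_le hm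
  have e1 : 2 * (2 + k) + 1 - 2 = 2 * k + 3 := by omega
  have e2 : 2 * (2 + k) + 1 - 2 * (2 + k) = 1 := by omega
  have e3 : 2 + k - 1 = k + 1 := by omega
  have e4 : 2 * (2 + k) = 2 * k + 3 + 1 := by omega
  have e5 : (2 * k + 3).choose (2 + k) = (2 * k + 3).choose (k + 1) :=
    Nat.choose_symm_of_eq_add (by omega)
  rw [e1, e2, e3, e4, e5, Nat.choose_succ_succ (2 * k + 3) k]
  have : 0 < (2 * k + 3).choose k := Nat.choose_pos (by omega)
  simp
  omega

theorem preservesDist_of_even {m : ℕ} {φ : Word (2 * m + 1) → Word (2 * m + 1)}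
    (hφ : Function.Bijective φ) (hm : PreservesDist φ m) (he : Even m) (h2 : 2 ≤ m) :
    PreservesDist φ (2 * m) := by
  intro x y
  have hc := sphereCount_map hφ hm (preservesDist_add_two hφ hm he) x y
  have h := two_or_preserved hφ hm x y
  constructor
  · intro h1
    rcases h.1 (Or.inr h1) with h3 | h3
    · exact absurd hc (sphereCount_two_ne h2 h3 h1)
    · exact h3
  · intro h1
    rcases h.2 (Or.inr h1) with h3 | h3
    · exact absurd hc.symm (sphereCount_two_ne h2 h3 h1)
    · exact h3

/-! ### Complementation, and isometries from distance one -/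

theorem eq_add_one_of_hammingDist_eq {n : ℕ} {x y : Word n} (h : hammingDist x y = n) :
    y = x + 1 := by
  have h1 : diffSet x y = Finset.univ := by
    rw [← Finset.card_eq_iff_eq_univ, card_diffSet, h, Fintype.card_fin]
  have h2 := add_indicatorWord_diffSet x y
  rw [h1] at h2
  rw [← h2]
  ext i; simp [indicatorWord]

theorem hammingDist_add_one {n : ℕ} (x y : Word n) :
    hammingDist x (y + 1) + hammingDist x y = n := by
  rw [← card_diffSet, ← card_diffSet]
  have : diffSet x (y + 1) = (diffSet x y)ᶜ := by
    ext i
    simp only [diffSet, Finset.mem_compl, Finset.mem_filter, Finset.mem_univ, true_and,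
      Pi.add_apply, Pi.one_apply]
    generalize x i = a
    generalize y i = b
    revert a b; decide
  rw [this, add_comm, Finset.card_add_card_compl, Fintype.card_fin]

theorem map_add_one {n : ℕ} {φ : Word n → Word n} (h : PreservesDist φ n) (x : Word n) :
    φ (x + 1) = φ x + 1 := by
  refine eq_add_one_of_hammingDist_eq ((h _ _).2 ?_)
  have := hammingDist_add_one x x
  simpa using this

/-- Any two words are joined by a path of single-letter changes. -/
theorem hammingDist_map_le {n : ℕ} {φ : Word n → Word n}
    (h : ∀ x y, hammingDist x y = 1 → hammingDist (φ x) (φ y) = 1) (x y : Word n) :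
    hammingDist (φ x) (φ y) ≤ hammingDist x y := by
  induction hk : hammingDist x y generalizing x with
  | zero => rw [hammingDist_eq_zero] at hk; simp [hk]
  | succ k ih =>
    have hne : (diffSet x y).Nonempty := by
      rw [← Finset.card_pos, card_diffSet]; omega
    obtain ⟨i, hi⟩ := hne
    have h1 : diffSet x (x + indicatorWord {i}) = {i} := diffSet_add_indicatorWord _ _
    have h2 : hammingDist x (x + indicatorWord {i}) = 1 := by rw [← card_diffSet, h1]; simp
    have h3 : hammingDist (x + indicatorWord {i}) y = k := by
      rw [← card_diffSet, diffSet_symmDiff x, h1]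
      have := card_symmDiff_add (diffSet x y) {i}
      rw [card_diffSet, Finset.inter_singleton_of_mem hi] at this
      simp at this
      omega
    have := hammingDist_triangle (φ x) (φ (x + indicatorWord {i})) (φ y)
    have := ih _ h3
    have := h _ _ h2
    omega

theorem isCubeIsometry_of_preservesDist_one {n : ℕ} {φ : Word n → Word n}
    (hφ : Function.Bijective φ) (h : PreservesDist φ 1) : IsCubeIsometry φ := by
  refine ⟨hφ, fun x y => le_antisymm (hammingDist_map_le (fun a b => (h a b).2) x y) ?_⟩
  let e := Equiv.ofBijective φ hφ
  have := hammingDist_map_le (φ := e.symm) (fun a b hab => ?_) (φ x) (φ y)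
  · simpa [e, Equiv.ofBijective_symm_apply_apply] using this
  · rw [← h]
    have h1 : ∀ a, φ (e.symm a) = a := fun a => e.apply_symm_apply a
    rw [h1, h1]; exact hab

theorem isCubeIsometry_of_even {m : ℕ} (he : Even m) {φ : Word (2 * m + 1) → Word (2 * m + 1)}
    (hφ : Function.Bijective φ) (hm : PreservesDist φ m)
    (hn : PreservesDist φ (2 * m + 1)) : IsCubeIsometry φ := by
  refine isCubeIsometry_of_preservesDist_one hφ fun x y => ?_
  rcases Nat.lt_or_ge m 2 with h | h
  · obtain rfl : m = 0 := by obtain ⟨a, ha⟩ := he; omega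
    exact hn x y
  · have h1 := preservesDist_of_even hφ hm he h x (y + 1)
    rw [map_add_one hn] at h1
    have h2 := hammingDist_add_one x y
    have h3 := hammingDist_add_one (φ x) (φ y)
    omega

/-! ### Intersection-preserving maps on pairs of points -/

theorem exists_notMem_of_card_lt {ι : Type*} [Fintype ι] {S : Finset ι}
    (h : S.card < Fintype.card ι) : ∃ d, d ∉ S := by
  by_contra! hc
  rw [Finset.eq_univ_iff_forall.2 hc, Finset.card_univ] at h
  exact lt_irrefl _ h

/-- Four two-element sets that pairwise meet in one point have a common point. -/
theorem mem_of_card_inter_eq_one {ι : Type*} [DecidableEq ι] {A B C D : Finset ι} {x : ι}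
    (hA : A.card = 2) (hB : B.card = 2) (hC : C.card = 2)
    (hAB : (A ∩ B).card = 1) (hAC : (A ∩ C).card = 1) (hBC : (B ∩ C).card = 1)
    (hAD : (A ∩ D).card = 1) (hBD : (B ∩ D).card = 1) (hCD : (C ∩ D).card = 1)
    (hxA : x ∈ A) (hxB : x ∈ B) : x ∈ C := by
  by_contra hx
  have key : ∀ {X : Finset ι}, X.card = 2 → x ∈ X → ∃ y, y ≠ x ∧ X = {x, y} := by
    intro X hX hxX
    obtain ⟨a, b, hab, rfl⟩ := Finset.card_eq_two.1 hX
    rcases Finset.mem_insert.1 hxX with h | h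
    · exact ⟨b, by grind, by grind⟩
    · exact ⟨a, by grind, by grind⟩
  obtain ⟨y, hy, rfl⟩ := key hA hxA
  obtain ⟨z, hz, rfl⟩ := key hB hxB
  have hyz : y ≠ z := by rintro rfl; rw [Finset.inter_self] at hAB; omega
  have hyC : y ∈ C := by
    by_contra h
    rw [show ({x, y} : Finset ι) ∩ C = ∅ by grind] at hAC; simp at hAC
  have hzC : z ∈ C := by
    by_contra h
    rw [show ({x, z} : Finset ι) ∩ C = ∅ by grind] at hBC; simp at hBC
  have hC' : C = {y, z} := by
    refine (Finset.eq_of_subset_of_card_le (by grind) ?_).symm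
    rw [Finset.card_pair hyz, hC]
  subst hC'
  have hle : ∀ {X : Finset ι} {a b : ι}, X.card = 1 → a ∈ X → b ∈ X → a = b :=
    fun h ha hb => Finset.card_le_one.1 h.le _ ha _ hb
  have hne : ∀ {X : Finset ι}, X.card = 1 → ∃ a, a ∈ X := fun h =>
    Finset.card_pos.1 (by omega)
  -- The three pairs are now the sides of a triangle. Membership in `D` would be a proper
  -- two-colouring of it, which is impossible.
  obtain ⟨a, ha⟩ := hne hAD
  obtain ⟨b, hb⟩ := hne hBD
  obtain ⟨c, hc⟩ := hne hCD
  have h1 := @hle _ x y hAD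
  have h2 := @hle _ x z hBD
  have h3 := @hle _ y z hCD
  grind

/-- A map on pairs of points that preserves the sizes of intersections comes from a permutation
of the points. -/
theorem exists_perm_of_card_inter {ι : Type*} [Fintype ι] [DecidableEq ι]
    (h5 : 5 ≤ Fintype.card ι) (F : ι → ι → Finset ι)
    (H : ∀ p q r s, p ≠ q → r ≠ s →
      (F p q ∩ F r s).card = (({p, q} : Finset ι) ∩ {r, s}).card) :
    ∃ π : Equiv.Perm ι, ∀ p q, p ≠ q → F p q = {π p, π q} := by
  have hF2 : ∀ p q, p ≠ q → (F p q).card = 2 := by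
    intro p q hpq
    have := H p q p q hpq hpq
    rwa [Finset.inter_self, Finset.inter_self, Finset.card_pair hpq] at this
  have hstar : ∀ p a b, a ≠ p → b ≠ p → a ≠ b → (F p a ∩ F p b).card = 1 := by
    intro p a b ha hb hab
    rw [H p a p b ha.symm hb.symm, show ({p, a} : Finset ι) ∩ {p, b} = {p} by grind]
    simp
  have hpick : ∀ p a b c : ι, ∃ d, d ≠ p ∧ d ≠ a ∧ d ≠ b ∧ d ≠ c := by
    intro p a b c
    obtain ⟨d, hd⟩ := exists_notMem_of_card_lt (S := {p, a, b, c})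
      (lt_of_le_of_lt Finset.card_le_four (by omega))
    exact ⟨d, by grind⟩
  have hcentre : ∀ p, ∃ x, ∀ q, q ≠ p → x ∈ F p q := by
    intro p
    obtain ⟨a, ha, -⟩ := hpick p p p p
    obtain ⟨b, hb, hba, -⟩ := hpick p a a a
    obtain ⟨x, hx⟩ : (F p a ∩ F p b).Nonempty := by
      rw [← Finset.card_pos, hstar p a b ha hb hba.symm]; exact one_pos
    rw [Finset.mem_inter] at hx
    refine ⟨x, fun c hc => ?_⟩
    by_cases hca : c = a
    · rw [hca]; exact hx.1
    by_cases hcb : c = b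
    · rw [hcb]; exact hx.2
    -- The fourth pair `F p d` excludes the triangle; this is where five points are needed.
    obtain ⟨d, hdp, hda, hdb, hdc⟩ := hpick p a b c
    exact mem_of_card_inter_eq_one (hF2 p a ha.symm) (hF2 p b hb.symm) (hF2 p c hc.symm)
      (hstar p a b ha hb hba.symm) (hstar p a c ha hc (Ne.symm hca))
      (hstar p b c hb hc (Ne.symm hcb))
      (hstar p a d ha hdp hda.symm) (hstar p b d hb hdp hdb.symm) (hstar p c d hc hdp hdc.symm)
      hx.1 hx.2
  choose π hπ using hcentre
  have hinj : Function.Injective π := by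
    intro p q hpq
    by_contra hne
    obtain ⟨a, hap, haq, -⟩ := hpick p q q q
    obtain ⟨b, hbp, hbq, hba, -⟩ := hpick p q a a
    have h1 := H p a q b hap.symm hbq.symm
    rw [show ({p, a} : Finset ι) ∩ {q, b} = ∅ by grind, Finset.card_empty,
      Finset.card_eq_zero] at h1
    have : π p ∈ F p a ∩ F q b := Finset.mem_inter.2 ⟨hπ p a hap, hpq ▸ hπ q b hbq⟩
    rw [h1] at this
    exact absurd this (Finset.notMem_empty _)
  refine ⟨Equiv.ofBijective π (Finite.injective_iff_bijective.1 hinj), fun p q hpq => ?_⟩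
  have hsymm : F p q = F q p := by
    have h1 := H p q q p hpq hpq.symm
    rw [Finset.pair_comm q p, Finset.inter_self, Finset.card_pair hpq] at h1
    have e1 : F p q ∩ F q p = F p q :=
      Finset.eq_of_subset_of_card_le Finset.inter_subset_left (by rw [h1, hF2 p q hpq])
    have e2 : F p q ∩ F q p = F q p :=
      Finset.eq_of_subset_of_card_le Finset.inter_subset_right (by rw [h1, hF2 q p hpq.symm])
    rw [← e1, e2]
  symm
  refine Finset.eq_of_subset_of_card_le ?_ ?_
  · intro x hx
    simp only [Equiv.ofBijective_apply, Finset.mem_insert, Finset.mem_singleton] at hx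
    rcases hx with rfl | rfl
    · exact hπ p q hpq.symm
    · rw [hsymm]; exact hπ q p hpq
  · rw [hF2 p q hpq, Equiv.ofBijective_apply, Equiv.ofBijective_apply,
      Finset.card_pair (hinj.ne hpq)]

/-! ### Words as sets of extended positions -/

/-- The word encoded by a set of extended positions: the sum of the unit words of the positions
in `S`, where the extra position `none` contributes the all-ones word. -/
def code {n : ℕ} (S : Finset (Option (Fin n))) : Word n :=
  fun i => (if none ∈ S then 1 else 0) + (if some i ∈ S then 1 else 0)

theorem code_symmDiff {n : ℕ} (S T : Finset (Option (Fin n))) :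
    code (symmDiff S T) = code S + code T := by
  ext i
  simp only [code, Pi.add_apply, Finset.mem_symmDiff]
  by_cases h1 : none ∈ S <;> by_cases h2 : none ∈ T <;> by_cases h3 : some i ∈ S <;>
    by_cases h4 : some i ∈ T <;> simp [h1, h2, h3, h4] <;> decide

theorem code_empty {n : ℕ} : code (∅ : Finset (Option (Fin n))) = 0 := by
  ext i; simp [code]

theorem code_eq_zero {n : ℕ} {S : Finset (Option (Fin n))} (h : code S = 0) :
    S = ∅ ∨ S = Finset.univ := by
  have h1 : ∀ i, some i ∈ S ↔ none ∈ S := by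
    intro i
    have := congrFun h i
    by_cases h2 : none ∈ S <;> by_cases h3 : some i ∈ S <;> simp [code, h2, h3] at this ⊢
  by_cases h2 : none ∈ S
  · right
    ext p; cases p <;> simp [h1, h2]
  · left
    ext p; cases p <;> simp [h1, h2]

theorem word_two_eq_zero {n : ℕ} : (2 : Word n) = 0 := by
  ext i; exact (by decide : (2 : ZMod 2) = 0)

theorem word_add_self {n : ℕ} (x : Word n) : x + x = 0 := by
  rw [← two_mul, word_two_eq_zero, zero_mul]

theorem word_add_eq_zero_iff {n : ℕ} {x y : Word n} : x + y = 0 ↔ x = y := by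
  have := word_two_eq_zero (n := n)
  constructor <;> intro h <;> grind

/-- Only the empty set and the whole set of `n + 1` points encode `0`, and the symmetric difference
is too small to be the latter. -/
theorem code_injective_of_card {n : ℕ} {S T : Finset (Option (Fin n))} (h : code S = code T)
    (hc : S.card + T.card ≤ n) : S = T := by
  have h1 : code (symmDiff S T) = 0 := by rw [code_symmDiff, h, word_add_self]
  rcases code_eq_zero h1 with h2 | h2
  · exact symmDiff_eq_bot.1 h2
  · have h3 := card_symmDiff_add S T
    have h4 : (symmDiff S T).card = n + 1 := by rw [h2]; simp
    omega

theorem code_pair {n : ℕ} {p q : Option (Fin n)} (h : p ≠ q) :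
    code {p, q} = code {p} + code {q} := by
  rw [← code_symmDiff]
  congr 1
  ext r; simp only [Finset.mem_symmDiff, Finset.mem_insert, Finset.mem_singleton]; grind

theorem code_map_some {n : ℕ} (S : Finset (Fin n)) :
    code (S.map Function.Embedding.some) = indicatorWord S := by
  ext i; simp [code, indicatorWord]

theorem code_none_some {n : ℕ} (i : Fin n) :
    code {none, some i} = indicatorWord {i} + 1 := by
  ext k; simp [code, indicatorWord, add_comm]

theorem hammingDist_add_indicatorWord {n : ℕ} (x : Word n) (S : Finset (Fin n)) :
    hammingDist x (x + indicatorWord S) = S.card := by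
  rw [← card_diffSet, diffSet_add_indicatorWord]

/-- Two words differ by a coded pair exactly when their distance is `2` or `n - 1`. -/
theorem exists_code_pair_iff {m : ℕ} {x y : Word (2 * m + 1)} :
    (∃ S : Finset (Option (Fin (2 * m + 1))), S.card = 2 ∧ x + y = code S) ↔
      (hammingDist x y = 2 ∨ hammingDist x y = 2 * m) := by
  have h2 := word_two_eq_zero (n := 2 * m + 1)
  have hadd := hammingDist_add_one x y
  constructor
  · rintro ⟨S, hS, h⟩
    have hpair : ∀ i j, S = {some i, some j} → hammingDist x y = 2 := by
      rintro i j rfl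
      have hij : i ≠ j := by rintro rfl; simp at hS
      have h3 : y = x + indicatorWord {i, j} := by
        rw [← code_map_some]; simp; grind
      rw [h3, hammingDist_add_indicatorWord, Finset.card_pair hij]
    have hsingle : ∀ i, S = {none, some i} → hammingDist x y = 2 * m := by
      rintro i rfl
      rw [code_none_some] at h
      have h3 : y + 1 = x + indicatorWord {i} := by grind
      rw [h3, hammingDist_add_indicatorWord, Finset.card_singleton] at hadd
      omega
    obtain ⟨p, q, hpq, hpair'⟩ := Finset.card_eq_two.1 hS
    rcases p with _ | i <;> rcases q with _ | j
    · exact absurd rfl hpq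
    · exact Or.inr (hsingle j hpair')
    · exact Or.inr (hsingle i (by rw [hpair', Finset.pair_comm]))
    · exact Or.inl (hpair i j hpair')
  · rintro (h | h)
    · refine ⟨(diffSet x y).map Function.Embedding.some, by simpa [card_diffSet] using h, ?_⟩
      rw [code_map_some]
      have := add_indicatorWord_diffSet x y
      grind
    · have h1 : (diffSet x (y + 1)).card = 1 := by rw [card_diffSet]; omega
      obtain ⟨i, hi⟩ := Finset.card_eq_one.1 h1
      refine ⟨{none, some i}, by simp, ?_⟩
      have := add_indicatorWord_diffSet x (y + 1)
      rw [code_none_some, ← hi]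
      grind

/-! ### From local permutations to one global permutation -/

/-- Around every word, a bijection preserving `{2, n - 1}` permutes the extended positions. -/
theorem exists_local_perm {m : ℕ} (hm : 3 ≤ m) {φ : Word (2 * m + 1) → Word (2 * m + 1)}
    (hφ : Function.Bijective φ)
    (h : ∀ x y, (hammingDist (φ x) (φ y) = 2 ∨ hammingDist (φ x) (φ y) = 2 * m) ↔
      (hammingDist x y = 2 ∨ hammingDist x y = 2 * m)) (x : Word (2 * m + 1)) :
    ∃ π : Equiv.Perm (Option (Fin (2 * m + 1))), ∀ p q, p ≠ q →
      φ (x + code {p, q}) = φ x + code {π p, π q} := by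
  have h2 := word_two_eq_zero (n := 2 * m + 1)
  simp only [← exists_code_pair_iff] at h
  have hex : ∀ p q : Option (Fin (2 * m + 1)), ∃ S : Finset (Option (Fin (2 * m + 1))),
      p ≠ q → S.card = 2 ∧ φ x + φ (x + code {p, q}) = code S := by
    intro p q
    by_cases hpq : p = q
    · exact ⟨∅, fun h => absurd hpq h⟩
    · obtain ⟨S, hS⟩ := (h x (x + code {p, q})).2 ⟨{p, q}, Finset.card_pair hpq, by grind⟩
      exact ⟨S, fun _ => hS⟩
  choose F hF using hex
  -- Sets of sizes at most `4` and `2` have distinct codes because `4 + 2 ≤ 2m + 1`, which uses `m ≥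
  -- 3`.
  have hcode : ∀ U : Finset (Option (Fin (2 * m + 1))), U.card ≤ 4 →
      ((∃ S : Finset (Option (Fin (2 * m + 1))), S.card = 2 ∧ code U = code S) ↔
        U.card = 2) := by
    intro U hU
    refine ⟨?_, fun hU => ⟨U, hU, rfl⟩⟩
    rintro ⟨S, hS, hUS⟩
    rw [code_injective_of_card hUS (by omega), hS]
  have hzero : ∀ U : Finset (Option (Fin (2 * m + 1))), U.card ≤ 4 →
      (code U = 0 ↔ U.card = 0) := by
    intro U hU
    rw [Finset.card_eq_zero]
    refine ⟨fun h => ?_, fun h => by rw [h, code_empty]⟩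
    exact code_injective_of_card (h.trans code_empty.symm) (by simp; omega)
  obtain ⟨π, hπ⟩ := exists_perm_of_card_inter (by simp; omega) F (by
    intro p q r s hpq hrs
    have hU := card_symmDiff_add ({p, q} : Finset (Option (Fin (2 * m + 1)))) {r, s}
    have hW := card_symmDiff_add (F p q) (F r s)
    rw [Finset.card_pair hpq, Finset.card_pair hrs] at hU
    rw [(hF p q hpq).1, (hF r s hrs).1] at hW
    have eU : (x + code {p, q}) + (x + code {r, s}) =
        code (symmDiff ({p, q} : Finset (Option (Fin (2 * m + 1)))) {r, s}) := by
      rw [code_symmDiff]; grind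
    have eW : φ (x + code {p, q}) + φ (x + code {r, s}) = code (symmDiff (F p q) (F r s)) := by
      rw [code_symmDiff, ← (hF p q hpq).2, ← (hF r s hrs).2]; grind
    have h3 := h (x + code {p, q}) (x + code {r, s})
    rw [eU, eW, hcode _ (by omega), hcode _ (by omega)] at h3
    have h4 : φ (x + code {p, q}) + φ (x + code {r, s}) = 0 ↔
        (x + code {p, q}) + (x + code {r, s}) = 0 := by
      rw [word_add_eq_zero_iff, word_add_eq_zero_iff, hφ.1.eq_iff]
    rw [eU, eW, hzero _ (by omega), hzero _ (by omega)] at h4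
    -- Two pairs meet in `2`, `1` or `0` points as their symmetric difference has `0`, `2` or `4`:
    -- the neighbours are equal, adjacent, or neither.
    omega)
  refine ⟨π, fun p q hpq => ?_⟩
  have := (hF p q hpq).2
  rw [hπ p q hpq] at this
  grind

/-- Two pairs through `π a` meet only there, which forces `ρ a = π a`; the other values follow. -/
theorem perm_eq_of_pair_eq {ι : Type*} [Fintype ι] [DecidableEq ι] (h3 : 3 ≤ Fintype.card ι)
    {π ρ : Equiv.Perm ι} {a : ι}
    (h : ∀ r, r ≠ a → ({ρ a, ρ r} : Finset ι) = {π a, π r}) : ρ = π := by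
  obtain ⟨b, hb⟩ := exists_notMem_of_card_lt (S := {a}) (by simp; omega)
  obtain ⟨c, hc⟩ := exists_notMem_of_card_lt (S := {a, b})
    (lt_of_le_of_lt Finset.card_le_two (by omega))
  have hbc : π b ≠ π c := π.injective.ne (by grind)
  have ha : ρ a = π a := by
    have h1 := h b (by grind)
    have h2 := h c (by grind)
    have m1 : ρ a ∈ ({π a, π b} : Finset ι) := h1 ▸ by simp
    have m2 : ρ a ∈ ({π a, π c} : Finset ι) := h2 ▸ by simp
    grind
  ext r
  by_cases hr : r = a
  · rw [hr, ha]
  · have h1 := h r hr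
    have m1 : ρ r ∈ ({π a, π r} : Finset ι) := h1 ▸ by simp
    have : ρ r ≠ ρ a := ρ.injective.ne hr
    grind

/-- Every `x + code {a, b} + code {a, r}` is `x` itself or its neighbour `x + code {b, r}`, so the
permutation at `x` already gives its image. These pairs through `a` determine the new permutation.
-/
theorem local_perm_translate {m : ℕ} (hm : 3 ≤ m) {φ : Word (2 * m + 1) → Word (2 * m + 1)}
    (hφ : Function.Bijective φ)
    (h : ∀ x y, (hammingDist (φ x) (φ y) = 2 ∨ hammingDist (φ x) (φ y) = 2 * m) ↔
      (hammingDist x y = 2 ∨ hammingDist x y = 2 * m)) {x : Word (2 * m + 1)}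
    {π : Equiv.Perm (Option (Fin (2 * m + 1)))}
    (hπ : ∀ p q, p ≠ q → φ (x + code {p, q}) = φ x + code {π p, π q})
    {a b : Option (Fin (2 * m + 1))} (hab : a ≠ b) :
    ∀ p q, p ≠ q →
      φ (x + code {a, b} + code {p, q}) = φ (x + code {a, b}) + code {π p, π q} := by
  have h2 := word_two_eq_zero (n := 2 * m + 1)
  obtain ⟨ρ, hρ⟩ := exists_local_perm hm hφ h (x + code {a, b})
  suffices ρ = π by rwa [this] at hρ
  refine perm_eq_of_pair_eq (a := a) (by simp; omega) fun r hr => ?_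
  refine code_injective_of_card ?_ ?_
  · have h1 := hρ a r hr.symm
    rw [hπ a b hab] at h1
    by_cases hrb : r = b
    · subst hrb
      rw [add_assoc, word_add_self, add_zero] at h1
      grind
    · have h3 : x + code {a, b} + code {a, r} = x + code {b, r} := by
        rw [code_pair hab, code_pair (Ne.symm hr), code_pair (Ne.symm hrb)]; grind
      rw [h3, hπ b r (Ne.symm hrb), code_pair (π.injective.ne (Ne.symm hrb)),
        code_pair (π.injective.ne hab)] at h1
      rw [code_pair (π.injective.ne (Ne.symm hr))]
      grind
  · have h3 := Finset.card_le_two (a := ρ a) (b := ρ r)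
    have h4 := Finset.card_le_two (a := π a) (b := π r)
    omega

/-- Induction removes two points at a time; carrying the local rule along with the value of `φ` is
what makes the next step possible. -/
theorem map_code_of_even {m : ℕ} (hm : 3 ≤ m) {φ : Word (2 * m + 1) → Word (2 * m + 1)}
    (hφ : Function.Bijective φ) (h0 : φ 0 = 0)
    (h : ∀ x y, (hammingDist (φ x) (φ y) = 2 ∨ hammingDist (φ x) (φ y) = 2 * m) ↔
      (hammingDist x y = 2 ∨ hammingDist x y = 2 * m)) :
    ∃ π : Equiv.Perm (Option (Fin (2 * m + 1))), ∀ U : Finset (Option (Fin (2 * m + 1))),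
      Even U.card → φ (code U) = code (U.image π) ∧
        ∀ p q, p ≠ q → φ (code U + code {p, q}) = φ (code U) + code {π p, π q} := by
  obtain ⟨π, hπ⟩ := exists_local_perm hm hφ h 0
  refine ⟨π, fun U hU => ?_⟩
  induction hk : U.card using Nat.strong_induction_on generalizing U with
  | _ k ih =>
    rcases Nat.eq_zero_or_pos k with rfl | hpos
    · rw [Finset.card_eq_zero] at hk
      subst hk
      refine ⟨by simp [code_empty, h0], ?_⟩
      rw [code_empty]; exact hπ
    · have h1 : 1 < U.card := by obtain ⟨t, ht⟩ := hU; omega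
      obtain ⟨a, ha, b, hb, hab⟩ := Finset.one_lt_card.1 h1
      have hsub : {a, b} ⊆ U := by grind
      have hcard := Finset.card_sdiff_add_card_eq_card hsub
      rw [Finset.card_pair hab] at hcard
      obtain ⟨i1, i2⟩ := ih (U \ {a, b}).card (by omega) (U \ {a, b})
        (by obtain ⟨t, ht⟩ := hU; exact ⟨t - 1, by omega⟩) rfl
      have hU' : code U = code (U \ {a, b}) + code {a, b} := by
        rw [← code_symmDiff]; congr 1
        ext r; simp only [Finset.mem_symmDiff, Finset.mem_sdiff]; grind
      have hI : code (U.image π) = code ((U \ {a, b}).image π) + code {π a, π b} := by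
        rw [← code_symmDiff]; congr 1
        ext r
        obtain ⟨r, rfl⟩ := π.surjective r
        simp only [Finset.mem_symmDiff, Finset.mem_image, Finset.mem_insert,
          Finset.mem_singleton, EmbeddingLike.apply_eq_iff_eq, exists_eq_right]
        grind
      rw [hU', hI]
      exact ⟨by rw [i2 a b hab, i1], local_perm_translate hm hφ h i2 hab⟩

/-! ### Sigma-mappings as permutations of extended positions -/

theorem word_eq_code {n : ℕ} (c : Word n) :
    c = code ((diffSet 0 c).map Function.Embedding.some) := by
  rw [code_map_some]
  have := add_indicatorWord_diffSet 0 c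
  rw [zero_add] at this
  exact this.symm

theorem card_map_diffSet {n : ℕ} (c : Word n) :
    ((diffSet 0 c).map Function.Embedding.some).card = hammingNorm c := by
  rw [Finset.card_map, card_diffSet, hammingDist_zero_left]

theorem hammingNorm_add_one {n : ℕ} (c : Word n) :
    hammingNorm (c + 1) + hammingNorm c = n := by
  have := hammingDist_add_one 0 c
  rwa [hammingDist_zero_left] at this

/-- The `σ_{i,j}`-mapping as an additive map. -/
def sigmaMap {n : ℕ} (i j : Fin n) (σ : {k : Fin n // k ≠ i} ≃ {k : Fin n // k ≠ j}) :
    Word n →+ Word n where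
  toFun c k := if h : k = j then c i else c (σ.symm ⟨k, h⟩) + c i
  map_zero' := by ext k; by_cases h : k = j <;> simp [h]
  map_add' x y := by ext k; by_cases h : k = j <;> simp [h]; ring

theorem sigmaMap_apply_self {n : ℕ} (i j : Fin n)
    (σ : {k : Fin n // k ≠ i} ≃ {k : Fin n // k ≠ j}) (c : Word n) : sigmaMap i j σ c j = c i := by
  simp [sigmaMap]

theorem sigmaMap_apply {n : ℕ} (i j : Fin n)
    (σ : {k : Fin n // k ≠ i} ≃ {k : Fin n // k ≠ j}) (c : Word n) (l : {k : Fin n // k ≠ i}) :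
    sigmaMap i j σ c (σ l) = c l + c i := by
  simp [sigmaMap, (σ l).2]

theorem isSigmaMappingOf_sigmaMap {n : ℕ} (i j : Fin n)
    (σ : {k : Fin n // k ≠ i} ≃ {k : Fin n // k ≠ j}) : IsSigmaMappingOf i j σ (sigmaMap i j σ) := by
  intro c
  refine ⟨fun h => ⟨fun k => ?_, by rw [sigmaMap_apply_self, h]⟩,
    fun h => ⟨fun k => ?_, by rw [sigmaMap_apply_self, h]⟩⟩ <;>
  · obtain ⟨l, rfl⟩ := σ.surjective k
    simp [sigmaMap_apply, h]

theorem IsSigmaMappingOf.eq_sigmaMap {n : ℕ} {i j : Fin n}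
    {σ : {k : Fin n // k ≠ i} ≃ {k : Fin n // k ≠ j}} {τ : Word n → Word n}
    (h : IsSigmaMappingOf i j σ τ) : τ = sigmaMap i j σ := by
  funext c k
  have h01 : c i = 0 ∨ c i = 1 := by generalize c i = a; revert a; decide
  by_cases hk : k = j
  · subst hk
    rw [sigmaMap_apply_self]
    rcases h01 with hc | hc
    · rw [((h c).1 hc).2, hc]
    · rw [((h c).2 hc).2, hc]
  · obtain ⟨l, hl⟩ := σ.surjective ⟨k, hk⟩
    obtain rfl : (σ l : Fin n) = k := congrArg Subtype.val hl
    rw [sigmaMap_apply]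
    rcases h01 with hc | hc
    · rw [((h c).1 hc).1, hc, σ.symm_apply_apply, add_zero]
    · rw [((h c).2 hc).1, hc, σ.symm_apply_apply]

/-- The all-ones word goes to the unit word at `j`, whose complement is `onesExcept j`:
complementing before and after yields the twist. -/
theorem sigmaMap_add_one {n : ℕ} (i j : Fin n)
    (σ : {k : Fin n // k ≠ i} ≃ {k : Fin n // k ≠ j}) (c : Word n) :
    sigmaMap i j σ (c + 1) + 1 = sigmaMap i j σ c + onesExcept j := by
  rw [map_add, add_assoc]
  congr 1
  funext k
  by_cases hk : k = j
  · subst hk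
    simp only [Pi.add_apply, sigmaMap_apply_self, Pi.one_apply, onesExcept, if_true]
    exact (by decide : (1 : ZMod 2) + 1 = 0)
  · obtain ⟨l, hl⟩ := σ.surjective ⟨k, hk⟩
    obtain rfl : (σ l : Fin n) = k := congrArg Subtype.val hl
    simp only [Pi.add_apply, sigmaMap_apply, Pi.one_apply, onesExcept, hk, if_false]
    exact (by decide : (1 : ZMod 2) + 1 + 1 = 1)

/-- A permutation of the extended positions that moves `none` induces a bijection between the
positions other than `i` and the positions other than `j`. -/
theorem exists_equiv_of_perm {α : Type*} {π : Equiv.Perm (Option α)} {i j : α}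
    (hi : π (some i) = none) (hj : π none = some j) :
    ∃ σ : {k : α // k ≠ i} ≃ {k : α // k ≠ j}, ∀ l : {k : α // k ≠ i}, π (some (l : α)) = some (σ l : α) := by
  have h1 : ∀ l : {k : α // k ≠ i}, ∃ k : {k : α // k ≠ j}, π (some l) = some (k : α) := by
    rintro ⟨l, hl⟩
    rcases hk : π (some l) with _ | k
    · exact absurd (Option.some_injective _ (π.injective (hk.trans hi.symm))) hl
    · refine ⟨⟨k, ?_⟩, rfl⟩
      rintro rfl
      exact absurd (π.injective (hk.trans hj.symm)) (by simp)
  have h2 : ∀ k : {k : α // k ≠ j}, ∃ l : {k : α // k ≠ i}, π (some l) = some (k : α) := by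
    rintro ⟨k, hk⟩
    obtain ⟨l | l, hl⟩ := π.surjective (some k)
    · exact absurd (Option.some_injective _ (hl.symm.trans hj)) hk
    · refine ⟨⟨l, ?_⟩, hl⟩
      rintro rfl
      rw [hi] at hl
      exact absurd hl (by simp)
  choose f hf using h1
  choose g hg using h2
  refine ⟨⟨f, g, fun l => ?_, fun k => ?_⟩, hf⟩
  · exact Subtype.ext (Option.some_injective _ (π.injective ((hg _).trans (hf l).symm)))
  · exact Subtype.ext (Option.some_injective _ ((hf _).symm.trans (hg k)))

/-- Since `π` sends `some i` to `none`, the entry at `i` becomes the contribution added to all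
positions. -/
theorem code_image_eq_sigmaMap {n : ℕ} {π : Equiv.Perm (Option (Fin n))} {i j : Fin n}
    {σ : {k : Fin n // k ≠ i} ≃ {k : Fin n // k ≠ j}} (hi : π (some i) = none)
    (hj : π none = some j)
    (hσ : ∀ l : {k : Fin n // k ≠ i}, π (some (l : Fin n)) = some (σ l : Fin n))
    (S : Finset (Fin n)) :
    code ((S.map Function.Embedding.some).image π) = sigmaMap i j σ (indicatorWord S) := by
  have hmem : ∀ p, π p ∈ (S.map Function.Embedding.some).image π ↔
      p ∈ S.map Function.Embedding.some := fun p => by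
    simp only [Finset.mem_image, EmbeddingLike.apply_eq_iff_eq, exists_eq_right]
  have hi' := hmem (some i)
  rw [hi] at hi'
  have hsome : ∀ l, some l ∈ S.map Function.Embedding.some ↔ l ∈ S := by simp
  funext k
  by_cases hk : k = j
  · subst hk
    have hj' := hmem none
    rw [hj] at hj'
    rw [sigmaMap_apply_self]
    simp only [code, indicatorWord, hi', hj', hsome]
    simp
  · obtain ⟨l, hl⟩ := σ.surjective ⟨k, hk⟩
    obtain rfl : (σ l : Fin n) = k := congrArg Subtype.val hl
    have hl' := hmem (some l)
    rw [hσ] at hl'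
    rw [sigmaMap_apply]
    simp only [code, indicatorWord, hi', hl', hsome]
    exact add_comm _ _

theorem isCubeIsometry_or_isTwisted {m : ℕ} (hm : 3 ≤ m)
    {φ : Word (2 * m + 1) → Word (2 * m + 1)} (hφ : Function.Bijective φ) (h0 : φ 0 = 0)
    (hd : PreservesDist φ m) (hn : PreservesDist φ (2 * m + 1)) :
    IsCubeIsometry φ ∨ IsTwistedSigmaMapping φ := by
  have h2 := word_two_eq_zero (n := 2 * m + 1)
  obtain ⟨π, hπ⟩ := map_code_of_even hm hφ h0 (two_or_preserved hφ hd)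
  have hneg := map_add_one hn
  have hparity : ∀ c : Word (2 * m + 1), Odd (hammingNorm c) → Even (hammingNorm (c + 1)) := by
    rintro c ⟨t, ht⟩
    have := hammingNorm_add_one c
    exact ⟨m - t, by omega⟩
  have heven : ∀ c : Word (2 * m + 1), Even (hammingNorm c) → ∀ p q, p ≠ q →
      φ (c + code {p, q}) = φ c + code {π p, π q} := by
    intro c hc
    have := (hπ _ (by rwa [card_map_diffSet c])).2
    rwa [← word_eq_code c] at this
  have hall : ∀ c : Word (2 * m + 1), ∀ p q, p ≠ q →
      φ (c + code {p, q}) = φ c + code {π p, π q} := by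
    intro c p q hpq
    rcases Nat.even_or_odd (hammingNorm c) with hc | hc
    · exact heven c hc p q hpq
    -- As `n` is odd, complementation exchanges even and odd weights.
    · have h3 := heven (c + 1) (hparity c hc) p q hpq
      rw [add_right_comm, hneg, hneg] at h3
      grind
  rcases hj : π none with _ | j
  · left
    have hw : IsWeakIsometry {1} φ := by
      refine ⟨hφ, ?_⟩
      rintro p hp x y hxy
      rw [Set.mem_singleton_iff] at hp
      subst hp
      obtain ⟨i, hi⟩ := Finset.card_eq_one.1 (show (diffSet x y).card = 1 from hxy)
      have hy := add_indicatorWord_diffSet x y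
      rcases hk : π (some i) with _ | k
      · exact absurd (π.injective (hk.trans hj.symm)) (by simp)
      -- The pair `{none, some i}` flips letter `i` and complements; commuting with complementation
      -- leaves a single changed letter.
      · have h3 := hall x none (some i) (by simp)
        rw [hj, hk, code_none_some, code_none_some, ← hi, ← add_assoc, hy, hneg] at h3
        have h4 : φ y = φ x + indicatorWord {k} := by grind
        rw [h4, hammingDist_add_indicatorWord, Finset.card_singleton]
    exact isCubeIsometry_of_preservesDist_one hφ (hw.preservesDist rfl)
  · right
    obtain ⟨i | i, hi⟩ := π.surjective none
    · rw [hj] at hi; exact absurd hi (by simp)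
    obtain ⟨σ, hσ⟩ := exists_equiv_of_perm hi hj
    have heq : ∀ c : Word (2 * m + 1), Even (hammingNorm c) → φ c = sigmaMap i j σ c := by
      intro c hc
      have h3 := (hπ _ (by rwa [card_map_diffSet c])).1
      rwa [code_image_eq_sigmaMap hi hj hσ, ← code_map_some, ← word_eq_code c] at h3
    refine ⟨i, j, sigmaMap i j σ, ⟨σ, isSigmaMappingOf_sigmaMap i j σ⟩, heq, fun c hc => ?_⟩
    have h3 := heq (c + 1) (hparity c hc)
    have h4 := sigmaMap_add_one i j σ c
    rw [← h3, hneg, add_assoc, word_add_self, add_zero] at h4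
    exact h4

/-! ### The converse: weights under twisted mappings -/

theorem hammingNorm_eq_add {n : ℕ} (c : Word n) (i : Fin n) :
    hammingNorm c = (if c i = 0 then 0 else 1) +
      (Finset.univ.filter fun l : {k : Fin n // k ≠ i} => c l ≠ 0).card := by
  have h := Fintype.sum_eq_add_sum_subtype_ne (fun k => if c k ≠ 0 then (1 : ℕ) else 0) i
  rw [hammingNorm, Finset.card_filter, Finset.card_filter, h]
  simp only [ne_eq, ite_not]

/-- The parity of the weight as an additive map. -/
def parity {n : ℕ} : Word n →+ ZMod 2 where
  toFun c := ∑ k, c k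
  map_zero' := by simp
  map_add' x y := by simp [Finset.sum_add_distrib]

theorem parity_eq {n : ℕ} (c : Word n) : parity c = (hammingNorm c : ZMod 2) := by
  change ∑ k, c k = _
  rw [hammingNorm, Finset.card_filter, Nat.cast_sum]
  refine Finset.sum_congr rfl fun k _ => ?_
  generalize c k = a
  revert a; decide

/-- The twisted `σ_{i,j}`-mapping as an additive map. -/
def twistedMap {n : ℕ} (i j : Fin n) (σ : {k : Fin n // k ≠ i} ≃ {k : Fin n // k ≠ j}) :
    Word n →+ Word n where
  toFun c := sigmaMap i j σ c + parity c • onesExcept j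
  map_zero' := by simp
  map_add' x y := by rw [map_add, map_add, add_smul]; abel

/-- Writing the twist as a multiple by the parity makes the two cases one additive map, so distances
reduce to weights. -/
theorem IsTwistedSigmaMapping.exists_eq_twistedMap {n : ℕ} {φ : Word n → Word n}
    (h : IsTwistedSigmaMapping φ) : ∃ i j σ, φ = twistedMap (n := n) i j σ := by
  obtain ⟨i, j, τ, ⟨σ, hσ⟩, he, ho⟩ := h
  refine ⟨i, j, σ, funext fun c => ?_⟩
  rw [hσ.eq_sigmaMap] at he ho
  change φ c = sigmaMap i j σ c + parity c • onesExcept j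
  rw [parity_eq]
  rcases Nat.even_or_odd (hammingNorm c) with hc | hc
  · rw [he c hc, (ZMod.natCast_eq_zero_iff_even).2 hc, zero_smul, add_zero]
  · rw [ho c hc, (ZMod.natCast_eq_one_iff_odd).2 hc, one_smul]
    rfl

theorem twistedMap_apply_self {n : ℕ} (i j : Fin n)
    (σ : {k : Fin n // k ≠ i} ≃ {k : Fin n // k ≠ j}) (c : Word n) :
    twistedMap i j σ c j = c i := by
  change sigmaMap i j σ c j + parity c • onesExcept j j = c i
  rw [sigmaMap_apply_self]; simp [onesExcept]

theorem twistedMap_apply {n : ℕ} (i j : Fin n)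
    (σ : {k : Fin n // k ≠ i} ≃ {k : Fin n // k ≠ j}) (c : Word n) (l : {k : Fin n // k ≠ i}) :
    twistedMap i j σ c (σ l) = c l + (c i + parity c) := by
  change sigmaMap i j σ c (σ l) + parity c • onesExcept j (σ l) = _
  rw [sigmaMap_apply]; simp [onesExcept, (σ l).2, add_assoc]

/-- A twisted mapping keeps the weight of a word, or reflects an odd weight at `(n - 1) / 2`, or
reflects an even weight at `(n + 1) / 2`. -/
theorem hammingNorm_twistedMap {n : ℕ} (i j : Fin n)
    (σ : {k : Fin n // k ≠ i} ≃ {k : Fin n // k ≠ j}) (c : Word n) :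
    hammingNorm (twistedMap i j σ c) = hammingNorm c ∨
    (Odd (hammingNorm c) ∧ hammingNorm (twistedMap i j σ c) + hammingNorm c + 1 = n) ∨
    (Even (hammingNorm c) ∧ hammingNorm (twistedMap i j σ c) + hammingNorm c = n + 1) := by
  have h1 := hammingNorm_eq_add c i
  have h2 := hammingNorm_eq_add (twistedMap i j σ c) j
  have h3 : (Finset.univ.filter fun l : {k : Fin n // k ≠ j} => twistedMap i j σ c l ≠ 0).card =
      (Finset.univ.filter fun l : {k : Fin n // k ≠ i} => c l + (c i + parity c) ≠ 0).card := by
    symm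
    refine Finset.card_bijective σ σ.bijective fun l => ?_
    simp only [Finset.mem_filter, Finset.mem_univ, true_and, twistedMap_apply]
  have h4 : (Finset.univ.filter fun l : {k : Fin n // k ≠ i} => c l ≠ 0).card +
      (Finset.univ.filter fun l : {k : Fin n // k ≠ i} => c l + 1 ≠ 0).card + 1 = n := by
    have hflip : (Finset.univ.filter fun l : {k : Fin n // k ≠ i} => c l + 1 ≠ 0) =
        Finset.univ.filter fun l : {k : Fin n // k ≠ i} => ¬ c l ≠ 0 := by
      refine Finset.filter_congr fun l _ => ?_
      generalize c l = a
      revert a; decide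
    rw [hflip, Finset.card_filter_add_card_filter_not, Finset.card_univ,
      Fintype.card_subtype_compl, Fintype.card_fin, Fintype.card_subtype_eq]
    have := i.pos
    omega
  rw [twistedMap_apply_self, h3] at h2
  rw [parity_eq] at h2
  have h01 : c i = 0 ∨ c i = 1 := by generalize c i = a; revert a; decide
  rcases Nat.even_or_odd (hammingNorm c) with hp | hp
  · rw [(ZMod.natCast_eq_zero_iff_even).2 hp] at h2
    rcases h01 with hc | hc
    · left
      simp only [hc, add_zero] at h1 h2
      omega
    · right; right
      refine ⟨hp, ?_⟩
      simp only [hc, add_zero, one_ne_zero, if_false] at h1 h2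
      omega
  · rw [(ZMod.natCast_eq_one_iff_odd).2 hp] at h2
    rcases h01 with hc | hc
    · right; left
      refine ⟨hp, ?_⟩
      simp only [hc, zero_add, if_true] at h1 h2
      omega
    · left
      simp only [hc, show (1 : ZMod 2) + 1 = 0 by decide, add_zero, one_ne_zero, if_false] at h1 h2
      omega

theorem isWeakIsometry_twistedMap {m : ℕ} (hm : Odd m) (i j : Fin (2 * m + 1))
    (σ : {k : Fin (2 * m + 1) // k ≠ i} ≃ {k : Fin (2 * m + 1) // k ≠ j}) :
    IsWeakIsometry {m, m + 1, 2 * m + 1} (twistedMap i j σ) := by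
  obtain ⟨t, ht⟩ := hm
  constructor
  · refine Finite.injective_iff_bijective.1 ((injective_iff_map_eq_zero _).2 fun c hc => ?_)
    have h := hammingNorm_twistedMap i j σ c
    rw [hc, hammingNorm_zero] at h
    have hle : hammingNorm c ≤ 2 * m + 1 := by simpa using hammingNorm_le_card_fintype (x := c)
    rcases h with h | ⟨⟨s, hs⟩, h⟩ | h
    · exact hammingNorm_eq_zero.1 h.symm
    · omega
    · omega
  · intro p hp x y hxy
    rw [hammingDist_eq_hammingNorm] at hxy ⊢
    rw [← map_neg, ← map_add]
    have h := hammingNorm_twistedMap i j σ (-x + y)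
    simp only [Set.mem_insert_iff, Set.mem_singleton_iff] at hp
    -- With `m` odd, `m` is the fixed point of the odd reflection and `m + 1` of the even one; the
    -- odd weight `n` cannot be reflected.
    rcases h with h | ⟨⟨s, hs⟩, h⟩ | ⟨⟨s, hs⟩, h⟩
    · omega
    · omega
    · omega

theorem mainTheorem2 (n : ℕ) :
    (n ≡ 1 [MOD 4] → ∀ φ : Word n → Word n,
      IsWeakIsometry {(n - 1) / 2, (n + 1) / 2, n} φ → φ 0 = 0 → IsCubeIsometry φ) ∧
    (n ≡ 3 [MOD 4] →
      (∀ φ : Word n → Word n,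
        IsWeakIsometry {(n - 1) / 2, (n + 1) / 2, n} φ → φ 0 = 0 → ¬ IsCubeIsometry φ →
          IsTwistedSigmaMapping φ) ∧
      (∀ φ : Word n → Word n, IsTwistedSigmaMapping φ →
        IsWeakIsometry {(n - 1) / 2, (n + 1) / 2, n} φ ∧ φ 0 = 0)) := by
  rcases Nat.even_or_odd n with ⟨t, ht⟩ | ⟨m, rfl⟩
  · constructor <;> intro h <;> rw [Nat.ModEq] at h <;> omega
  have e1 : (2 * m + 1 - 1) / 2 = m := by omega
  have e2 : (2 * m + 1 + 1) / 2 = m + 1 := by omega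
  rw [e1, e2]
  refine ⟨fun h φ hφ _ => ?_, fun h => ⟨fun φ hφ h0 hni => ?_, fun φ hφ => ?_⟩⟩
  · rw [Nat.ModEq] at h
    exact isCubeIsometry_of_even (Nat.even_iff.2 (by omega)) hφ.1 (hφ.preservesDist (by simp))
      (hφ.preservesDist (by simp))
  · rw [Nat.ModEq] at h
    rcases Nat.lt_or_ge m 3 with hm | hm
    -- For `n = 3` the distance `(n - 1) / 2` is `1`, so `φ` is already an isometry.
    · obtain rfl : m = 1 := by omega
      exact absurd (isCubeIsometry_of_preservesDist_one hφ.1 (hφ.preservesDist (by simp))) hni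
    · exact (isCubeIsometry_or_isTwisted hm hφ.1 h0 (hφ.preservesDist (by simp))
        (hφ.preservesDist (by simp))).resolve_left hni
  · rw [Nat.ModEq] at h
    obtain ⟨i, j, σ, rfl⟩ := hφ.exists_eq_twistedMap
    exact ⟨isWeakIsometry_twistedMap (Nat.odd_iff.2 (by omega)) i j σ, map_zero _⟩
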